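/- Let $\alpha\ge 2$ be a real number. An instance of $\mathrm{TSP}(2,\alpha)$ is a finite set $P\subset\mathbb{R}^2$ of $n\ge 2$ cities; an edge $pq$ has weight $|pq|^\alpha$, where $|pq|$ is the Euclidean distance, and the goal is to find a closed tour of minimum total weight that visits every city exactly once (for $n=2$ the tour traverses its only edge twice). For a tree $T$ and an edge $e=u_1u_2$ of $T$, the recursive procedure $\textsc{CycleInCube}(T,e)$ is as follows. For $i=1,2$ let $T_i$ be the component of $T-e$ that contains $u_i$. If $|T_i|=1$, put $\Pi_i=\emptyset$ and $w_i=u_i$. Otherwise pick an edge $e_i=u_iw_i$ of $T_i$ incident to $u_i$, and put $\Pi_i=e_i$ if $|T_i|=2$ and $\Pi_i=\textsc{CycleInCube}(T_i,e_i)-e_i$ if $|T_i|\ge 3$. Return $\Pi_1+e+\Pi_2+w_1w_2$. The geometric $\mathrm{T}^3$-algorithm computes a minimum spanning tree $T$ of the complete graph on $P$ with edge weights $|pq|^\alpha$, chooses an edge $e$ of $T$, and returns $\textsc{CycleInCube}(T,e)$, where each edge $e_i$ that is picked is one that makes the smallest angle with the current edge $e$ among all edges of $T_i$ incident to $u_i$.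 The choice of $T$, of the starting edge, and of an edge among several with the smallest angle is arbitrary. **Theorem.** For every $\alpha\ge 2$, the geometric $\mathrm{T}^3$-algorithm yields a $\left(3^{\alpha-1}+\sqrt{6}^{\,\alpha}/3\right)$-approximation for $\mathrm{TSP}(2,\alpha)$: on every instance the algorithm has an output, and, whatever choices it makes, its output is a tour that visits every city exactly once and whose weight is at most $3^{\alpha-1}+\sqrt{6}^{\,\alpha}/3$ times the weight of an optimal tour. -/

import Mathlib

namespace GeomT3

/-- Points of `d`-dimensional Euclidean space. -/
abbrev Pt (d : ℕ) := EuclideanSpace ℝ (Fin d)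

section Tours

variable {V : Type*}

/-- The edges of the closed tour `v₀, v₁, …, vₙ₋₁, v₀`, with multiplicity (for two vertices, the
single edge is traversed twice). -/
def closedTourEdges (l : List V) : Multiset (Sym2 V) :=
  (List.zipWith (fun a b => s(a, b)) l (l.rotate 1) : List (Sym2 V))

/-- `M` is the edge multiset of a closed tour that visits every vertex exactly once. -/
def IsTour (M : Multiset (Sym2 V)) : Prop :=
  ∃ l : List V, l.Nodup ∧ (∀ v, v ∈ l) ∧ M = closedTourEdges l

end Tours

section CycleInCube

variable {V : Type*}

/-- A rule for picking an edge. `pick F u v` is the other endpoint `w` of the edge `uw` that is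
picked at `u`, in the forest `F` from which the current edge `uv` has already been removed. -/
abbrev PickRule (V : Type*) := SimpleGraph V → V → V → V

/-- The number of vertices of the component of `F` that contains `u`. -/
noncomputable def componentSize (F : SimpleGraph V) (u : V) : ℕ :=
  (F.connectedComponentMk u).supp.ncard

theorem ncard_deleteEdges_lt [Finite V] {F : SimpleGraph V} {u v : V} (h : F.Adj u v) :
    (F.deleteEdges {s(u, v)}).edgeSet.ncard < F.edgeSet.ncard := by
  apply Set.ncard_lt_ncard _ (Set.toFinite _)
  rw [SimpleGraph.edgeSet_deleteEdges]
  exact ⟨Set.sdiff_subset, fun hs => (hs (F.mem_edgeSet.2 h)).2 rfl⟩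

open Classical in
/-- The recursive procedure `CycleInCube(T, u₁u₂)`, where the tree `T` is given as the component of
the forest `F` that contains the edge `u₁u₂`.

Let `F' = F - u₁u₂` and let `Tᵢ` be the component of `F'` that contains `uᵢ`.
If `|Tᵢ| = 1`, then `Πᵢ = ∅` and `wᵢ = uᵢ`. Otherwise an edge `uᵢwᵢ` of `Tᵢ` is picked, and `Πᵢ` is
`uᵢwᵢ` if `|Tᵢ| = 2`, and `CycleInCube(Tᵢ, uᵢwᵢ) - uᵢwᵢ` if `|Tᵢ| ≥ 3`.
The output is the multiset of edges `Π₁ + u₁u₂ + Π₂ + w₁w₂`.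
(The value is the irrelevant `0` if `u₁u₂` is not an edge.) -/
noncomputable def cycleInCube [Finite V] (pick : PickRule V) (F : SimpleGraph V) (u₁ u₂ : V) :
    Multiset (Sym2 V) :=
  if h : F.Adj u₁ u₂ then
    let F' := F.deleteEdges {s(u₁, u₂)}
    have : F'.edgeSet.ncard < F.edgeSet.ncard := ncard_deleteEdges_lt h
    let w₁ := if componentSize F' u₁ = 1 then u₁ else pick F' u₁ u₂
    let w₂ := if componentSize F' u₂ = 1 then u₂ else pick F' u₂ u₁
    let P₁ : Multiset (Sym2 V) :=
      if componentSize F' u₁ = 1 then 0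
      else if componentSize F' u₁ = 2 then {s(u₁, w₁)}
      else (cycleInCube pick F' u₁ w₁).erase s(u₁, w₁)
    let P₂ : Multiset (Sym2 V) :=
      if componentSize F' u₂ = 1 then 0
      else if componentSize F' u₂ = 2 then {s(u₂, w₂)}
      else (cycleInCube pick F' u₂ w₂).erase s(u₂, w₂)
    P₁ + {s(u₁, u₂)} + P₂ + {s(w₁, w₂)}
  else 0
termination_by F.edgeSet.ncard
decreasing_by all_goals exact ncard_deleteEdges_lt h

end CycleInCube

section Geometry

variable {d : ℕ} {P : Finset (Pt d)}

/-- The weight `|pq|^α` of the edge `pq`. -/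
noncomputable def edgeWeight (α : ℝ) : Sym2 P → ℝ :=
  Sym2.lift ⟨fun p q => dist (p : Pt d) (q : Pt d) ^ α, fun p q => by
    simp only [dist_comm]⟩

/-- The total weight of a multiset of edges. -/
noncomputable def weight (α : ℝ) (M : Multiset (Sym2 P)) : ℝ :=
  (M.map (edgeWeight α)).sum

open Classical in
/-- The total weight of the edges of a graph. -/
noncomputable def graphWeight (α : ℝ) (T : SimpleGraph P) : ℝ :=
  ∑ e ∈ T.edgeFinset, edgeWeight α e

/-- `T` is a minimum spanning tree of the complete graph on `P` with edge weights `|pq|^α`. -/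
def IsMST (α : ℝ) (T : SimpleGraph P) : Prop :=
  T.IsTree ∧ ∀ T' : SimpleGraph P, T'.IsTree → graphWeight α T ≤ graphWeight α T'

/-- The rule always picks an edge `uw` of the forest that makes the smallest angle (in `[0, π]`)
with the current edge `uv`; ties are broken in any way. -/
def IsGeometric (pick : PickRule P) : Prop :=
  ∀ (F : SimpleGraph P) (u v : P), (∃ w, F.Adj u w) →
    F.Adj u (pick F u v) ∧
      ∀ w, F.Adj u w →
        EuclideanGeometry.angle (pick F u v : Pt d) (u : Pt d) (v : Pt d) ≤
          EuclideanGeometry.angle (w : Pt d) (u : Pt d) (v : Pt d)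

end Geometry

/-- `M` is a possible output of the geometric `T³`-algorithm on `P`: compute a minimum spanning tree
`T`, choose an edge `u₁u₂` of `T`, and run `CycleInCube(T, u₁u₂)`, always picking an edge that makes
the smallest angle with the current edge. The tree, the starting edge and the way ties are
broken are arbitrary. -/
def GeometricT3 {d : ℕ} (α : ℝ) (P : Finset (Pt d)) (M : Multiset (Sym2 P)) : Prop :=
  ∃ (T : SimpleGraph P) (pick : PickRule P) (u₁ u₂ : P),
    IsMST α T ∧ IsGeometric pick ∧ T.Adj u₁ u₂ ∧ M = cycleInCube pick T u₁ u₂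

/-- The algorithm `A` (given by its possible outputs on each point set) is a `ρ`-approximation for
`Tsp(d, α)`: on every instance with at least two cities it has an output, and every possible output
is a tour whose weight is at most `ρ` times the weight of any tour. -/
def IsApproximation (d : ℕ) (α ρ : ℝ)
    (A : (P : Finset (Pt d)) → Multiset (Sym2 P) → Prop) : Prop :=
  ∀ P : Finset (Pt d), 2 ≤ P.card →
    (∃ M, A P M) ∧
      ∀ M, A P M → IsTour M ∧ ∀ M' : Multiset (Sym2 P), IsTour M' → weight α M ≤ ρ * weight α M'

end GeomT3

/-! Write `ρ` for the claimed ratio. A closed tour contains a spanning tree, so it suffices to bound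
the output by `ρ` times the weight of the tree. The output consists of tree edges and shortcuts
`w₁w₂`, and each shortcut is charged to the three tree edges `w₁u₁`, `u₁u₂`, `u₂w₂` that it
replaces.

The charge depends on the turns. Let `a`, `b` in `[0, 1]` measure how straight the path is at `u₁`
and `u₂`. The squared length of the shortcut is at most the sum of the squared edge lengths with
coefficients `2 + min 1 (2a²)`, `2 + a`, `2 + min 1 (2b²)` (`norm_add_add_sq_le`). The asymmetry is
deliberate: the middle edge pays only for the turn at `u₁`, the endpoint it shares with the
preceding edge of the recursion. The power mean inequality and convexity turn a coefficient `2 + t`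
into `coeff α t`, affine in `t` with `coeff α 0 + coeff α 1 = ρ` (`shortcut_le`).

A tree edge is an outer edge of at most one shortcut and the middle edge of at most one. When it
plays both roles, both charges concern turns at the same vertex, and the smallest-angle rule makes
the two parameters sum to at most `1` (`bend_add_bend_le`), so the total charge is at most `ρ`. An
edge that stays in the output pays `1` and, apart from the edge itself, at most one charge, which is
also within `ρ` (`one_add_coeff_le`). `weight_cycleInCube_le` carries this out by induction. -/

namespace GeomT3

/-! ### Squared length of a three-edge shortcut in an inner product space. -/

section ShortcutLength

variable {E : Type*} [NormedAddCommGroup E] [InnerProductSpace ℝ E]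

open InnerProductGeometry

/-- The condition on `p` and `q` says `1/p + 1/q = 1`; multiplied by `p - 1`, the difference of the
two sides is a perfect square. -/
theorem add_sq_le_of_weights {p q : ℝ} (u v : ℝ) (hp : 0 < p) (hq : 0 < q)
    (h : (p - 1) * (q - 1) = 1) : (u + v) ^ 2 ≤ p * u ^ 2 + q * v ^ 2 := by
  have hp1 : 0 < p - 1 := by
    by_contra hc
    nlinarith [mul_pos hp hq]
  have key : (p - 1) * ((p - 1) * u ^ 2 - 2 * u * v + (q - 1) * v ^ 2)
      = ((p - 1) * u - v) ^ 2 := by linear_combination v ^ 2 * h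
  have : 0 ≤ (p - 1) * u ^ 2 - 2 * u * v + (q - 1) * v ^ 2 :=
    nonneg_of_mul_nonneg_right (key ▸ sq_nonneg _) hp1
  linarith

/-- Weighted Cauchy–Schwarz: the difference of the two sides is the variance of `u/r₁`, `v/r₂`,
`w/r₃` under the probabilities `rᵢ`. -/
theorem add_add_sq_le_of_weights {r₁ r₂ r₃ : ℝ} (u v w : ℝ) (h₁ : 0 < r₁) (h₂ : 0 < r₂)
    (h₃ : 0 < r₃) (h : r₁ + r₂ + r₃ = 1) :
    (u + v + w) ^ 2 ≤ u ^ 2 / r₁ + v ^ 2 / r₂ + w ^ 2 / r₃ := by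
  have key : u ^ 2 / r₁ + v ^ 2 / r₂ + w ^ 2 / r₃ - (u + v + w) ^ 2
      = r₁ * (u / r₁ - (u + v + w)) ^ 2 + r₂ * (v / r₂ - (u + v + w)) ^ 2
        + r₃ * (w / r₃ - (u + v + w)) ^ 2 := by
    field_simp
    obtain rfl : r₃ = 1 - r₁ - r₂ := by linarith
    ring
  have : 0 ≤ r₁ * (u / r₁ - (u + v + w)) ^ 2 + r₂ * (v / r₂ - (u + v + w)) ^ 2
        + r₃ * (w / r₃ - (u + v + w)) ^ 2 := by positivity
  linarith

/-- Splitting off the components along `Y` of the two outer vectors. -/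
theorem norm_add_add_sq_le_of_weights {p q : ℝ} (X Y Z : E) (hp : 0 < p) (hq : 0 < q)
    (h : (p - 1) * (q - 1) = 1) (hY : Y ≠ 0) :
    ‖X + Y + Z‖ ^ 2 ≤
      (Real.cos (angle X Y) * ‖X‖ + ‖Y‖ + Real.cos (angle Y Z) * ‖Z‖) ^ 2
        + p * ((1 - Real.cos (angle X Y) ^ 2) * ‖X‖ ^ 2)
        + q * ((1 - Real.cos (angle Y Z) ^ 2) * ‖Z‖ ^ 2) := by
  have hy : 0 < ‖Y‖ := norm_pos_iff.2 hY
  set a := Real.cos (angle X Y) * ‖X‖ with ha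
  set b := Real.cos (angle Y Z) * ‖Z‖ with hb
  have hXY : inner ℝ X Y = a * ‖Y‖ := by
    rw [ha, ← cos_angle_mul_norm_mul_norm]; ring
  have hZY : inner ℝ Z Y = b * ‖Y‖ := by
    rw [hb, real_inner_comm, ← cos_angle_mul_norm_mul_norm]; ring
  set e : E := ‖Y‖⁻¹ • Y with he
  have hee : inner ℝ e e = (1 : ℝ) := by
    rw [he, real_inner_smul_left, real_inner_smul_right, real_inner_self_eq_norm_sq]
    field_simp
  have hYe : Y = ‖Y‖ • e := by rw [he, smul_smul, mul_inv_cancel₀ hy.ne', one_smul]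
  have hXe : inner ℝ X e = a := by
    rw [he, real_inner_smul_right, hXY]; field_simp
  have hZe : inner ℝ Z e = b := by
    rw [he, real_inner_smul_right, hZY]; field_simp
  -- `X'` and `Z'` are the parts orthogonal to `Y`; by Pythagoras only their sum has to be
  -- estimated, with the weights `p` and `q`.
  set X' := X - a • e with hX'
  set Z' := Z - b • e with hZ'
  have hX'e : inner ℝ X' e = (0 : ℝ) := by
    rw [hX', inner_sub_left, real_inner_smul_left, hXe, hee]; ring
  have hZ'e : inner ℝ Z' e = (0 : ℝ) := by
    rw [hZ', inner_sub_left, real_inner_smul_left, hZe, hee]; ring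
  have hnX : ‖X'‖ ^ 2 = ‖X‖ ^ 2 - a ^ 2 := by
    rw [hX', norm_sub_sq_real, real_inner_smul_right, hXe, norm_smul, mul_pow,
      ← real_inner_self_eq_norm_sq e, hee, Real.norm_eq_abs, sq_abs]
    ring
  have hnZ : ‖Z'‖ ^ 2 = ‖Z‖ ^ 2 - b ^ 2 := by
    rw [hZ', norm_sub_sq_real, real_inner_smul_right, hZe, norm_smul, mul_pow,
      ← real_inner_self_eq_norm_sq e, hee, Real.norm_eq_abs, sq_abs]
    ring
  have hsum : X + Y + Z = (a + ‖Y‖ + b) • e + (X' + Z') := by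
    rw [hX', hZ', add_smul, add_smul, ← hYe]; abel
  have hsq : ‖X + Y + Z‖ ^ 2 = (a + ‖Y‖ + b) ^ 2 + ‖X' + Z'‖ ^ 2 := by
    rw [hsum, norm_add_sq_real, real_inner_smul_left, real_inner_comm, inner_add_left, hX'e,
      hZ'e, norm_smul, mul_pow, ← real_inner_self_eq_norm_sq e, hee, Real.norm_eq_abs, sq_abs]
    ring
  have htri : ‖X' + Z'‖ ^ 2 ≤ (‖X'‖ + ‖Z'‖) ^ 2 := by
    gcongr
    exact norm_add_le _ _
  have := add_sq_le_of_weights ‖X'‖ ‖Z'‖ hp hq h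
  rw [hnX, hnZ] at this
  rw [hsq]
  have hX : (1 - Real.cos (angle X Y) ^ 2) * ‖X‖ ^ 2 = ‖X‖ ^ 2 - a ^ 2 := by rw [ha]; ring
  have hZ : (1 - Real.cos (angle Y Z) ^ 2) * ‖Z‖ ^ 2 = ‖Z‖ ^ 2 - b ^ 2 := by rw [hb]; ring
  rw [hX, hZ]
  linarith

/-- With a turn of at least a right angle, `‖X + Y‖²` is at most `‖X‖² + ‖Y‖²`, and adding `Z` costs
a factor `2`. -/
theorem norm_add_add_sq_le_two_mul {X Y : E} (Z : E) (h : inner ℝ X Y ≤ 0) :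
    ‖X + Y + Z‖ ^ 2 ≤ 2 * ‖X‖ ^ 2 + 2 * ‖Y‖ ^ 2 + 2 * ‖Z‖ ^ 2 := by
  have h1 : ‖X + Y + Z‖ ^ 2 ≤ (‖X + Y‖ + ‖Z‖) ^ 2 := by
    gcongr
    exact norm_add_le _ _
  have h2 := norm_add_sq_real X Y
  nlinarith [sq_nonneg (‖X + Y‖ - ‖Z‖)]

/-- The coefficients of the three edges in the bound on the length of a shortcut. -/
theorem norm_add_add_sq_le (X Y Z : E) {a b : ℝ} (ha : a = max 0 (Real.cos (angle X Y)))
    (hb : b = max 0 (Real.cos (angle Y Z))) :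
    ‖X + Y + Z‖ ^ 2 ≤ (2 + min 1 (2 * a ^ 2)) * ‖X‖ ^ 2 + (2 + a) * ‖Y‖ ^ 2
      + (2 + min 1 (2 * b ^ 2)) * ‖Z‖ ^ 2 := by
  have ha0 : 0 ≤ a := ha ▸ le_max_left _ _
  have hb0 : 0 ≤ b := hb ▸ le_max_left _ _
  have ha1 : a ≤ 1 := ha ▸ max_le zero_le_one (Real.cos_le_one _)
  have hb1 : b ≤ 1 := hb ▸ max_le zero_le_one (Real.cos_le_one _)
  have hma : 0 ≤ min 1 (2 * a ^ 2) := le_min zero_le_one (by positivity)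
  have hmb : 0 ≤ min 1 (2 * b ^ 2) := le_min zero_le_one (by positivity)
  have base : ‖X + Y + Z‖ ^ 2 ≤ 2 * ‖X‖ ^ 2 + 2 * ‖Y‖ ^ 2 + 2 * ‖Z‖ ^ 2 →
      ‖X + Y + Z‖ ^ 2 ≤ (2 + min 1 (2 * a ^ 2)) * ‖X‖ ^ 2 + (2 + a) * ‖Y‖ ^ 2
      + (2 + min 1 (2 * b ^ 2)) * ‖Z‖ ^ 2 := fun h => h.trans (by gcongr <;> linarith)
  by_cases hXY : Real.cos (angle X Y) ≤ 0
  · refine base (norm_add_add_sq_le_two_mul Z ?_)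
    rw [← cos_angle_mul_norm_mul_norm]
    exact mul_nonpos_of_nonpos_of_nonneg hXY (by positivity)
  by_cases hYZ : Real.cos (angle Y Z) ≤ 0
  · refine base ?_
    have := norm_add_add_sq_le_two_mul (X := Z) (Y := Y) X (by
      rw [real_inner_comm, ← cos_angle_mul_norm_mul_norm]
      exact mul_nonpos_of_nonpos_of_nonneg hYZ (by positivity))
    rw [show X + Y + Z = Z + Y + X by abel]
    linarith
  have hY : Y ≠ 0 := by
    rintro rfl
    simp at hXY
  push Not at hXY hYZ
  rw [max_eq_right hXY.le] at ha
  rw [max_eq_right hYZ.le] at hb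
  have split := fun {p q : ℝ} (hp : 0 < p) (hq : 0 < q) (h : (p - 1) * (q - 1) = 1) =>
    norm_add_add_sq_le_of_weights X Y Z hp hq h hY
  rw [← ha, ← hb] at split
  rw [← ha] at hXY
  rw [← hb] at hYZ
  generalize ‖X + Y + Z‖ ^ 2 = S at *
  have hx : 0 ≤ ‖X‖ := norm_nonneg _
  have hy : 0 ≤ ‖Y‖ := norm_nonneg _
  have hz : 0 ≤ ‖Z‖ := norm_nonneg _
  generalize ‖X‖ = x at *
  generalize ‖Y‖ = y at *
  generalize ‖Z‖ = z at *
  -- Both turns are now less than a right angle. The weights `p`, `q` split the components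
  -- orthogonal to `Y` and `r₁`, `r₂`, `r₃` those along `Y`; what remains is one scalar inequality
  -- per edge.
  have comb : ∀ {p q r₁ r₂ r₃ : ℝ}, 0 < p → 0 < q → (p - 1) * (q - 1) = 1 → 0 < r₁ → 0 < r₂ →
      0 < r₃ → r₁ + r₂ + r₃ = 1 → a ^ 2 / r₁ + p * (1 - a ^ 2) ≤ 2 + min 1 (2 * a ^ 2) →
      1 / r₂ ≤ 2 + a → b ^ 2 / r₃ + q * (1 - b ^ 2) ≤ 2 + min 1 (2 * b ^ 2) →
      S ≤ (2 + min 1 (2 * a ^ 2)) * x ^ 2 + (2 + a) * y ^ 2 + (2 + min 1 (2 * b ^ 2)) * z ^ 2 := by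
    intro p q r₁ r₂ r₃ hp hq hpq h₁ h₂ h₃ hr hX hY hZ
    have e₁ := mul_le_mul_of_nonneg_right hX (sq_nonneg x)
    have e₂ := mul_le_mul_of_nonneg_right hY (sq_nonneg y)
    have e₃ := mul_le_mul_of_nonneg_right hZ (sq_nonneg z)
    have e₄ := add_add_sq_le_of_weights (a * x) y (b * z) h₁ h₂ h₃ hr
    have e₅ := split hp hq hpq
    have e₆ : (a * x) ^ 2 / r₁ + y ^ 2 / r₂ + (b * z) ^ 2 / r₃
        = a ^ 2 / r₁ * x ^ 2 + 1 / r₂ * y ^ 2 + b ^ 2 / r₃ * z ^ 2 := by ring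
    linarith
  -- The cases record which argument attains each minimum. For an outer edge, `p = 2`, `r = 1/4`
  -- gives exactly `2 + 2a²`, and `p = 3`, `r = 1/3` gives exactly `3`. In the mixed cases the
  -- conjugate weight `3/2` falls to the other edge, and its `r` is chosen to leave the middle edge
  -- an `r₂` with `1/r₂ ≤ 2 + a`.
  rcases le_total (2 * a ^ 2) 1 with hA | hA <;> rcases le_total (2 * b ^ 2) 1 with hB | hB
  · rw [min_eq_right hA, min_eq_right hB] at *
    refine comb (p := 2) (q := 2) (r₁ := 1 / 4) (r₂ := 1 / 2) (r₃ := 1 / 4) ?_ ?_ ?_ ?_ ?_ ?_ ?_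
      ?_ ?_ ?_ <;> norm_num <;> linarith
  · rw [min_eq_right hA, min_eq_left hB] at *
    rcases le_total a (2 / 5) with h5 | h5
    · have : a ^ 2 ≤ (2 / 5) ^ 2 := by gcongr
      refine comb (p := 3 / 2) (q := 3) (r₁ := 1 / 6) (r₂ := 1 / 2) (r₃ := 1 / 3) ?_ ?_ ?_ ?_ ?_ ?_
        ?_ ?_ ?_ ?_ <;> norm_num <;> linarith
    · refine comb (p := 3 / 2) (q := 3) (r₁ := 1 / 4) (r₂ := 5 / 12) (r₃ := 1 / 3) ?_ ?_ ?_ ?_ ?_ ?_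
        ?_ ?_ ?_ ?_ <;> norm_num <;> linarith
  · rw [min_eq_left hA, min_eq_right hB] at *
    have : 2 / 3 ≤ a := by nlinarith
    refine comb (p := 3) (q := 3 / 2) (r₁ := 1 / 3) (r₂ := 3 / 8) (r₃ := 7 / 24) ?_ ?_ ?_ ?_ ?_ ?_
        ?_ ?_ ?_ ?_ <;> norm_num <;> linarith
  · rw [min_eq_left hA, min_eq_left hB] at *
    have h2a : (0 : ℝ) < 2 + a := by linarith
    have hr : (1 + 2 * a) / (3 * (2 + a)) + 1 / (2 + a) + 1 / 3 = 1 := by field_simp; ring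
    -- Here `r₂` makes the middle inequality an equality, `r₃ = 1/3`, and `r₁` is what is left of
    -- the total `1`.
    refine comb (p := 2) (q := 2) (r₁ := (1 + 2 * a) / (3 * (2 + a))) (r₂ := 1 / (2 + a))
      (r₃ := 1 / 3) (by norm_num) (by norm_num) (by norm_num) (by positivity) (by positivity)
      (by norm_num) hr ?_ (by simp) (by norm_num; nlinarith)
    have : a ^ 2 / ((1 + 2 * a) / (3 * (2 + a))) ≤ 1 + 2 * a ^ 2 := by
      rw [div_div_eq_mul_div, div_le_iff₀ (by positivity)]
      nlinarith [mul_nonneg (sub_nonneg.2 ha1) (by nlinarith : 0 ≤ 1 + 3 * a - a ^ 2)]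
    linarith

/-- If `Y` is no farther from `X` in angle than `Z` is, then `X, Y` and `Y, Z` cannot both be
almost opposite. -/
theorem bend_add_bend_le (X Y Z : E) (h : angle Y X ≤ angle Z X) :
    min 1 (2 * max 0 (-Real.cos (angle Y X)) ^ 2) + max 0 (-Real.cos (angle Z Y)) ≤ 1 := by
  rcases le_total (-Real.cos (angle Z Y)) 0 with hZ | hZ
  · rw [max_eq_left hZ, add_zero]; exact min_le_left _ _
  rcases le_total (-Real.cos (angle Y X)) 0 with hY | hY
  · rw [max_eq_left hY, max_eq_right hZ]
    have := Real.neg_one_le_cos (angle Z Y)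
    norm_num
    linarith
  rw [max_eq_right hZ, max_eq_right hY]
  refine (add_le_add_left (min_le_right _ _) _).trans ?_
  -- The triangle inequality for angles through `-X` says that the three pairwise angles sum to at
  -- most `2π`; the hypothesis then replaces `angle Z X` by the smaller `angle Y X`.
  have tri : angle Z Y ≤ 2 * Real.pi - 2 * angle Y X := by
    have := angle_le_angle_add_angle Z (-X) Y
    rw [angle_neg_right, angle_neg_left, angle_comm X Y] at this
    linarith
  -- This puts `2π - 2 * angle Y X` into `[0, π]`, where cosine is decreasing; the double angle
  -- formula then produces the term `2cos²`.
  have hYpi : Real.pi / 2 ≤ angle Y X := by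
    by_contra hc
    push Not at hc
    have := Real.cos_pos_of_mem_Ioo ⟨by linarith [angle_nonneg Y X, Real.pi_pos], hc⟩
    linarith
  have hcos := Real.cos_le_cos_of_nonneg_of_le_pi (angle_nonneg Z Y) (by linarith) tri
  rw [Real.cos_two_pi_sub, Real.cos_two_mul] at hcos
  linarith

end ShortcutLength

/-! ### From squared lengths to `α`-th powers. -/

section Coefficients

/-- The coefficient of the `α`-th power of a length whose square has the coefficient `2 + t`. -/
noncomputable def coeff (α t : ℝ) : ℝ :=
  Real.sqrt 6 ^ α / 3 + t * ((3 : ℝ) ^ (α - 1) - Real.sqrt 6 ^ α / 3)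

variable {α : ℝ}

theorem sqrt_six_rpow (α : ℝ) : Real.sqrt 6 ^ α / 3 = 3 ^ (α / 2 - 1) * 2 ^ (α / 2) := by
  rw [Real.sqrt_eq_rpow, ← Real.rpow_mul (by norm_num), Real.rpow_sub_one (by norm_num),
    show (6 : ℝ) = 3 * 2 by norm_num, Real.mul_rpow (by norm_num) (by norm_num),
    show 1 / 2 * α = α / 2 by ring]
  ring

theorem three_rpow_sub_one (α : ℝ) : (3 : ℝ) ^ (α - 1) = 3 ^ (α / 2 - 1) * 3 ^ (α / 2) := by
  rw [← Real.rpow_add (by norm_num)]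
  congr 1
  ring

theorem one_le_sqrt_six_rpow (hα : 2 ≤ α) : 1 ≤ Real.sqrt 6 ^ α / 3 := by
  have h1 : (1 : ℝ) ≤ Real.sqrt 6 := by rw [Real.one_le_sqrt]; norm_num
  have : Real.sqrt 6 ^ (2 : ℝ) ≤ Real.sqrt 6 ^ α := Real.rpow_le_rpow_of_exponent_le h1 hα
  rw [Real.rpow_two, Real.sq_sqrt (by norm_num)] at this
  linarith

theorem sqrt_six_rpow_le (hα : 2 ≤ α) : Real.sqrt 6 ^ α / 3 ≤ 3 ^ (α - 1) := by
  rw [sqrt_six_rpow, three_rpow_sub_one α]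
  gcongr
  linarith

theorem coeff_mono (hα : 2 ≤ α) : Monotone (coeff α) := fun s t hst => by
  have := sqrt_six_rpow_le hα
  unfold coeff
  nlinarith

theorem coeff_one : coeff α 1 = 3 ^ (α - 1) := by simp [coeff]

theorem coeff_add_coeff_le (hα : 2 ≤ α) {s t : ℝ} (h : s + t ≤ 1) :
    coeff α s + coeff α t ≤ 3 ^ (α - 1) + Real.sqrt 6 ^ α / 3 := by
  have := sqrt_six_rpow_le hα
  unfold coeff
  nlinarith

theorem one_add_coeff_le (hα : 2 ≤ α) {t : ℝ} (h : t ≤ 1) :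
    1 + coeff α t ≤ 3 ^ (α - 1) + Real.sqrt 6 ^ α / 3 := by
  have h1 := one_le_sqrt_six_rpow hα
  have h2 := coeff_mono hα h
  rw [coeff_one] at h2
  linarith

/-- The right side is the chord from `t = 0` to `t = 1` of the left side, which is convex in `t`
because `α / 2 ≥ 1`. -/
theorem rpow_mul_rpow_le_coeff (hα : 2 ≤ α) {t : ℝ} (h0 : 0 ≤ t) (h1 : t ≤ 1) :
    (3 : ℝ) ^ (α / 2 - 1) * (2 + t) ^ (α / 2) ≤ coeff α t := by
  have hc := (convexOn_rpow (p := α / 2) (by linarith)).2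
    (show (2 : ℝ) ∈ Set.Ici 0 by norm_num) (show (3 : ℝ) ∈ Set.Ici 0 by norm_num)
    (sub_nonneg.2 h1) h0 (by ring)
  simp only [smul_eq_mul] at hc
  rw [show (1 - t) * 2 + t * 3 = 2 + t by ring] at hc
  refine (mul_le_mul_of_nonneg_left hc (by positivity)).trans (le_of_eq ?_)
  rw [coeff, sqrt_six_rpow, three_rpow_sub_one α]
  ring

/-- The power mean inequality for three terms with exponent `α / 2` supplies the factor `3 ^ (α / 2
- 1)`; each term is then replaced by its chord bound. -/
theorem rpow_le_coeff_of_sq_le (hα : 2 ≤ α) {S x y z r s t : ℝ} (hS : 0 ≤ S) (hx : 0 ≤ x)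
    (hy : 0 ≤ y) (hz : 0 ≤ z) (hr0 : 0 ≤ r) (hr1 : r ≤ 1) (hs0 : 0 ≤ s) (hs1 : s ≤ 1)
    (ht0 : 0 ≤ t) (ht1 : t ≤ 1)
    (h : S ^ 2 ≤ (2 + r) * x ^ 2 + (2 + s) * y ^ 2 + (2 + t) * z ^ 2) :
    S ^ α ≤ coeff α r * x ^ α + coeff α s * y ^ α + coeff α t * z ^ α := by
  have hpow : ∀ {v : ℝ}, 0 ≤ v → (v ^ 2) ^ (α / 2) = v ^ α := fun hv => by
    rw [← Real.rpow_natCast, ← Real.rpow_mul hv]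
    congr 1
    push_cast
    ring
  have hmean := Real.rpow_sum_le_const_mul_sum_rpow_of_nonneg (Finset.univ : Finset (Fin 3))
    (f := ![(2 + r) * x ^ 2, (2 + s) * y ^ 2, (2 + t) * z ^ 2]) (p := α / 2) (by linarith)
    (by intro i _; fin_cases i <;> simp <;> positivity)
  simp only [Fin.sum_univ_three, Finset.card_univ, Fintype.card_fin, Matrix.cons_val_zero,
    Matrix.cons_val_one, Matrix.cons_val] at hmean
  have term : ∀ {v k : ℝ}, 0 ≤ v → 0 ≤ k → k ≤ 1 →
      (3 : ℝ) ^ (α / 2 - 1) * ((2 + k) * v ^ 2) ^ (α / 2) ≤ coeff α k * v ^ α := by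
    intro v k hv h0 h1
    rw [Real.mul_rpow (by linarith) (by positivity), hpow hv, ← mul_assoc]
    exact mul_le_mul_of_nonneg_right (rpow_mul_rpow_le_coeff hα h0 h1) (Real.rpow_nonneg hv _)
  calc S ^ α = (S ^ 2) ^ (α / 2) := (hpow hS).symm
    _ ≤ ((2 + r) * x ^ 2 + (2 + s) * y ^ 2 + (2 + t) * z ^ 2) ^ (α / 2) :=
        Real.rpow_le_rpow (by positivity) h (by linarith)
    _ ≤ _ := hmean
    _ = 3 ^ (α / 2 - 1) * ((2 + r) * x ^ 2) ^ (α / 2) + 3 ^ (α / 2 - 1) * ((2 + s) * y ^ 2) ^ (α / 2)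
        + 3 ^ (α / 2 - 1) * ((2 + t) * z ^ 2) ^ (α / 2) := by push_cast; ring
    _ ≤ _ := add_le_add (add_le_add (term hx hr0 hr1) (term hy hs0 hs1)) (term hz ht0 ht1)

variable {d : ℕ}

/-- How much the path `w, u, v` goes straight on at `u`: `1` if it does not turn, and `0` if it
turns by a right angle or more. -/
noncomputable def bend (w u v : Pt d) : ℝ :=
  max 0 (-Real.cos (EuclideanGeometry.angle w u v))

theorem bend_nonneg (w u v : Pt d) : 0 ≤ bend w u v := le_max_left _ _

theorem bend_le_one (w u v : Pt d) : bend w u v ≤ 1 :=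
  max_le zero_le_one (by linarith [Real.neg_one_le_cos (EuclideanGeometry.angle w u v)])

/-- An angle with a zero side is `π / 2` by convention, so an empty path `Πᵢ`, where `wᵢ = uᵢ`,
needs no separate treatment in the shortcut bound. -/
theorem bend_self_left (u v : Pt d) : bend u u v = 0 := by
  simp [bend, EuclideanGeometry.angle]

theorem bend_add_bend_le_one {u v w x : Pt d}
    (h : EuclideanGeometry.angle w u v ≤ EuclideanGeometry.angle x u v) :
    min 1 (2 * bend w u v ^ 2) + bend x u w ≤ 1 :=
  bend_add_bend_le _ _ _ h

theorem shortcut_le (hα : 2 ≤ α) (w₁ u₁ u₂ w₂ : Pt d) :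
    dist w₁ w₂ ^ α ≤ coeff α (min 1 (2 * bend w₁ u₁ u₂ ^ 2)) * dist u₁ w₁ ^ α
      + coeff α (bend w₁ u₁ u₂) * dist u₁ u₂ ^ α
      + coeff α (min 1 (2 * bend w₂ u₂ u₁ ^ 2)) * dist u₂ w₂ ^ α := by
  refine rpow_le_coeff_of_sq_le hα dist_nonneg dist_nonneg dist_nonneg dist_nonneg
    (le_min zero_le_one (by positivity)) (min_le_left _ _) (bend_nonneg _ _ _) (bend_le_one _ _ _)
    (le_min zero_le_one (by positivity)) (min_le_left _ _) ?_
  have := norm_add_add_sq_le (u₁ - w₁) (u₂ - u₁) (w₂ - u₂)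
    (a := bend w₁ u₁ u₂) (b := bend w₂ u₂ u₁)
    (by
      rw [bend, EuclideanGeometry.angle, vsub_eq_sub, vsub_eq_sub, ← neg_sub u₁ w₁,
        InnerProductGeometry.angle_neg_left, Real.cos_pi_sub, neg_neg])
    (by
      rw [bend, EuclideanGeometry.angle, vsub_eq_sub, vsub_eq_sub, ← neg_sub u₂ u₁,
        InnerProductGeometry.angle_neg_right, Real.cos_pi_sub, neg_neg,
        InnerProductGeometry.angle_comm])
  rw [show u₁ - w₁ + (u₂ - u₁) + (w₂ - u₂) = w₂ - w₁ by abel] at this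
  rwa [dist_comm w₁ w₂, dist_eq_norm w₂ w₁, dist_eq_norm u₁ w₁, dist_comm u₁ u₂,
    dist_eq_norm u₂ u₁, dist_comm u₂ w₂, dist_eq_norm w₂ u₂]

end Coefficients

/-! ### Edge multisets of paths and closed tours. -/

section PathEdges

variable {V : Type*}

/-- The edges of the path through the vertices of `l`, in this order. -/
def pathEdges : List V → Multiset (Sym2 V)
  | a :: b :: l => s(a, b) ::ₘ pathEdges (b :: l)
  | _ => 0

theorem pathEdges_append {a b : V} : ∀ {l₁ l₂ : List V}, a ∈ l₁.getLast? → b ∈ l₂.head? →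
    pathEdges (l₁ ++ l₂) = pathEdges l₁ + {s(a, b)} + pathEdges l₂
  | [], _, h, _ => by simp at h
  | [c], [], _, h => by simp at h
  | [c], e :: l, h, h' => by
    simp only [List.getLast?_singleton, Option.mem_def, Option.some.injEq, List.head?_cons] at h h'
    subst h h'
    simp [pathEdges]
  | c :: e :: l, l₂, h, h' => by
    have := pathEdges_append (l₁ := e :: l) (l₂ := l₂) (by simpa using h) h'
    simp only [List.cons_append] at this
    simp only [List.cons_append, pathEdges, this, Multiset.cons_add]

theorem pathEdges_reverse : ∀ l : List V, pathEdges l.reverse = pathEdges l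
  | [] => rfl
  | [_] => rfl
  | a :: b :: l => by
    rw [List.reverse_cons, pathEdges_append (a := b) (b := a) (by simp) (by simp),
      pathEdges_reverse (b :: l), Sym2.eq_swap]
    simp only [pathEdges, add_zero]
    rw [add_comm, Multiset.singleton_add]

theorem closedTourEdges_eq {l : List V} {a b : V} (ha : a ∈ l.head?) (hb : b ∈ l.getLast?) :
    closedTourEdges l = pathEdges l + {s(a, b)} := by
  -- The closing vertex `a` stays fixed while the head `x` varies, which is what lets the induction
  -- pass to the tail.
  have key : ∀ (t : List V) (x : V), b ∈ (x :: t).getLast? →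
      ((List.zipWith (fun a b => s(a, b)) (x :: t) (t ++ [a]) : List (Sym2 V)) :
        Multiset (Sym2 V)) = pathEdges (x :: t) + {s(a, b)} := by
    intro t
    induction t with
    | nil =>
      intro x hx
      simp only [List.getLast?_singleton, Option.mem_def, Option.some.injEq] at hx
      subst hx
      simp [pathEdges, Sym2.eq_swap]
    | cons y t ih =>
      intro x hx
      have := ih y (by simpa using hx)
      rw [List.cons_append, List.zipWith_cons_cons, ← Multiset.cons_coe, this, pathEdges,
        Multiset.cons_add]
  match l, ha with
  | c :: t, ha =>
    simp only [List.head?_cons, Option.mem_def, Option.some.injEq] at ha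
    subst ha
    rw [closedTourEdges, List.rotate_cons_succ, List.rotate_zero]
    exact key t c hb

theorem reachable_of_pathEdges {G : SimpleGraph V} : ∀ {a : V} {l : List V},
    (∀ u v, s(u, v) ∈ pathEdges (a :: l) → G.Reachable u v) → ∀ v ∈ a :: l, G.Reachable a v
  | a, [], _, v, hv => by
    simp only [List.mem_singleton] at hv
    exact hv ▸ .rfl
  | a, b :: l, h, v, hv => by
    rcases List.mem_cons.1 hv with rfl | hv
    · exact .rfl
    · exact (h a b (by simp [pathEdges])).trans
        (reachable_of_pathEdges (fun u v huv => h u v (by simp [pathEdges, huv])) v hv)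

end PathEdges

/-! ### The recursion produces a Hamiltonian cycle. -/

section Recursion

variable {V : Type*}

open SimpleGraph

theorem not_reachable_deleteEdges {F : SimpleGraph V} (hF : F.IsAcyclic) {u v : V}
    (h : F.Adj u v) : ¬(F.deleteEdges {s(u, v)}).Reachable u v :=
  isBridge_iff.1 (isAcyclic_iff_forall_isBridge.1 hF (F.mem_edgeSet.2 h))

theorem reachable_iff_deleteEdges {F : SimpleGraph V} {u₁ u₂ : V} (h : F.Adj u₁ u₂) (v : V) :
    F.Reachable u₁ v ↔ (F.deleteEdges {s(u₁, u₂)}).Reachable u₁ v ∨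
      (F.deleteEdges {s(u₁, u₂)}).Reachable u₂ v := by
  constructor
  · have step : ∀ {x y : V}, F.Walk x y → ((F.deleteEdges {s(u₁, u₂)}).Reachable u₁ x ∨
        (F.deleteEdges {s(u₁, u₂)}).Reachable u₂ x) →
        ((F.deleteEdges {s(u₁, u₂)}).Reachable u₁ y ∨
        (F.deleteEdges {s(u₁, u₂)}).Reachable u₂ y) := by
      intro x y p
      induction p with
      | nil => exact id
      | @cons x z y hxz _ ih =>
        intro hx
        apply ih
        by_cases he : s(x, z) = s(u₁, u₂)
        · rcases Sym2.eq_iff.1 he with ⟨-, rfl⟩ | ⟨-, rfl⟩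
          · exact .inr .rfl
          · exact .inl .rfl
        · have hadj : (F.deleteEdges {s(u₁, u₂)}).Adj x z := deleteEdges_adj.2 ⟨hxz, he⟩
          exact hx.imp (·.trans hadj.reachable) (·.trans hadj.reachable)
    rintro ⟨p⟩
    exact step p (.inl .rfl)
  · rintro (hv | hv)
    · exact hv.mono (deleteEdges_le _)
    · exact h.reachable.trans (hv.mono (deleteEdges_le _))

theorem componentSize_eq_one_iff [Finite V] {F : SimpleGraph V} {u : V} :
    componentSize F u = 1 ↔ ∀ v, F.Reachable u v ↔ v = u := by
  rw [componentSize, Set.ncard_eq_one]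
  constructor
  · rintro ⟨a, ha⟩ v
    have hmem : ∀ v, F.Reachable u v ↔ v = a := fun v => by
      have := Set.ext_iff.1 ha v
      rw [ConnectedComponent.mem_supp_iff, ConnectedComponent.eq] at this
      exact reachable_comm.trans this
    obtain rfl := (hmem u).1 .rfl
    exact hmem v
  · intro h
    refine ⟨u, Set.ext fun v => ?_⟩
    rw [ConnectedComponent.mem_supp_iff, ConnectedComponent.eq, reachable_comm]
    exact h v

theorem exists_adj_of_componentSize_ne_one [Finite V] {F : SimpleGraph V} {u : V}
    (h : componentSize F u ≠ 1) : ∃ w, F.Adj u w := by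
  by_contra! hc
  refine h (componentSize_eq_one_iff.2 fun v => ⟨?_, fun hv => hv ▸ .rfl⟩)
  rintro ⟨p⟩
  cases p with
  | nil => rfl
  | cons hadj _ => exact absurd hadj (hc _)

theorem reachable_iff_of_componentSize_eq_two [Finite V] {F : SimpleGraph V} {u w : V}
    (h : componentSize F u = 2) (hw : F.Adj u w) (v : V) :
    F.Reachable u v ↔ v = u ∨ v = w := by
  have hsub : ({u, w} : Set V) ⊆ (F.connectedComponentMk u).supp := by
    rintro x (rfl | rfl)
    · rfl
    · rw [ConnectedComponent.mem_supp_iff, ConnectedComponent.eq]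
      exact hw.symm.reachable
  have heq := Set.eq_of_subset_of_ncard_le hsub
    (by rw [Set.ncard_pair hw.ne]; exact h.le) (Set.toFinite _)
  have := Set.ext_iff.1 heq v
  rw [ConnectedComponent.mem_supp_iff, ConnectedComponent.eq] at this
  exact reachable_comm.trans this.symm

/-- The rule picks an edge whenever there is one. -/
def IsValid (pick : PickRule V) : Prop :=
  ∀ (F : SimpleGraph V) (u v : V), (∃ w, F.Adj u w) → F.Adj u (pick F u v)

open Classical in
/-- The vertex `wᵢ` of `cycleInCube`. -/
noncomputable def nextVertex (pick : PickRule V) (F : SimpleGraph V) (u v : V) : V :=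
  if componentSize F u = 1 then u else pick F u v

open Classical in
/-- The path `Πᵢ` of `cycleInCube`. -/
noncomputable def spur [Finite V] (pick : PickRule V) (F : SimpleGraph V) (u w : V) :
    Multiset (Sym2 V) :=
  if componentSize F u = 1 then 0
  else if componentSize F u = 2 then {s(u, w)}
  else (cycleInCube pick F u w).erase s(u, w)

theorem cycleInCube_eq [Finite V] (pick : PickRule V) {F : SimpleGraph V} {u₁ u₂ : V}
    (h : F.Adj u₁ u₂) :
    cycleInCube pick F u₁ u₂ =
      spur pick (F.deleteEdges {s(u₁, u₂)}) u₁ (nextVertex pick (F.deleteEdges {s(u₁, u₂)}) u₁ u₂)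
      + {s(u₁, u₂)}
      + spur pick (F.deleteEdges {s(u₁, u₂)}) u₂ (nextVertex pick (F.deleteEdges {s(u₁, u₂)}) u₂ u₁)
      + {s(nextVertex pick (F.deleteEdges {s(u₁, u₂)}) u₁ u₂,
          nextVertex pick (F.deleteEdges {s(u₁, u₂)}) u₂ u₁)} := by
  rw [cycleInCube, dif_pos h]
  rfl

variable [Finite V] {pick : PickRule V}

theorem adj_nextVertex (hp : IsValid pick) {F : SimpleGraph V} {u v : V}
    (h : componentSize F u ≠ 1) : F.Adj u (nextVertex pick F u v) := by
  rw [nextVertex, if_neg h]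
  exact hp _ _ _ (exists_adj_of_componentSize_ne_one h)

/-- `l` is a Hamiltonian path from `u` to `w` of the component of `u`. -/
structure IsSpanningPath (F : SimpleGraph V) (u w : V) (l : List V) : Prop where
  nodup : l.Nodup
  mem_iff : ∀ v, v ∈ l ↔ F.Reachable u v
  head : u ∈ l.head?
  last : w ∈ l.getLast?

theorem exists_isSpanningPath_spur (hp : IsValid pick) {F : SimpleGraph V}
    (ih : ∀ u w, F.Adj u w →
      ∃ l, IsSpanningPath F u w l ∧ cycleInCube pick F u w = pathEdges l + {s(u, w)}) (u v : V) :
    ∃ l, IsSpanningPath F u (nextVertex pick F u v) l ∧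
      spur pick F u (nextVertex pick F u v) = pathEdges l := by
  by_cases h1 : componentSize F u = 1
  · refine ⟨[u], ⟨by simp, fun v => ?_, by simp, by simp [nextVertex, h1]⟩,
      by simp [spur, h1, pathEdges]⟩
    rw [List.mem_singleton, componentSize_eq_one_iff.1 h1]
  have hadj := adj_nextVertex hp (v := v) h1
  by_cases h2 : componentSize F u = 2
  · refine ⟨[u, nextVertex pick F u v], ⟨by simpa using hadj.ne, fun v => ?_, by simp, by simp⟩,
      by simp [spur, h2, pathEdges]⟩
    rw [reachable_iff_of_componentSize_eq_two h2 hadj]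
    simp
  · obtain ⟨l, hl, heq⟩ := ih _ _ hadj
    refine ⟨l, hl, ?_⟩
    classical
    rw [spur, if_neg h1, if_neg h2, heq, add_comm, Multiset.singleton_add,
      Multiset.erase_cons_head]

/-- The current edge closes up a Hamiltonian path between its own endpoints, so erasing it in the
recursion leaves that path. The two paths, from `u₁` to `w₁` and from `w₂` to `u₂`, are joined by
`w₁w₂`. Multisets also cover a two-vertex tree, whose edge occurs twice. -/
theorem exists_isSpanningPath_cycleInCube (hp : IsValid pick) {F : SimpleGraph V}
    (hF : F.IsAcyclic) {u₁ u₂ : V} (h : F.Adj u₁ u₂) :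
    ∃ l, IsSpanningPath F u₁ u₂ l ∧ cycleInCube pick F u₁ u₂ = pathEdges l + {s(u₁, u₂)} := by
  induction hn : F.edgeSet.ncard using Nat.strong_induction_on generalizing F u₁ u₂ with
  | _ n ih =>
    subst hn
    have ih' := fun (u w : V) (huw : (F.deleteEdges {s(u₁, u₂)}).Adj u w) =>
      ih _ (ncard_deleteEdges_lt h) (hF.anti (deleteEdges_le _)) huw rfl
    rw [cycleInCube_eq pick h]
    obtain ⟨l₁, hl₁, e₁⟩ := exists_isSpanningPath_spur hp ih' u₁ u₂
    obtain ⟨l₂, hl₂, e₂⟩ := exists_isSpanningPath_spur hp ih' u₂ u₁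
    have hne₁ : l₁ ≠ [] := by rintro rfl; simpa using hl₁.head
    have hne₂ : l₂ ≠ [] := by rintro rfl; simpa using hl₂.head
    refine ⟨l₁ ++ l₂.reverse, ⟨?_, fun v => ?_, ?_, ?_⟩, ?_⟩
    · refine List.nodup_append'.2 ⟨hl₁.nodup, List.nodup_reverse.2 hl₂.nodup, fun v h₁ h₂ => ?_⟩
      rw [List.mem_reverse, hl₂.mem_iff] at h₂
      rw [hl₁.mem_iff] at h₁
      exact not_reachable_deleteEdges hF h (h₁.trans h₂.symm)
    · rw [List.mem_append, List.mem_reverse, hl₁.mem_iff, hl₂.mem_iff,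
        reachable_iff_deleteEdges h]
    · rw [List.head?_append_of_ne_nil _ hne₁]
      exact hl₁.head
    · rw [List.getLast?_append_of_ne_nil _ (by simpa using hne₂), List.getLast?_reverse]
      exact hl₂.head
    · rw [pathEdges_append hl₁.last (by rw [List.head?_reverse]; exact hl₂.last),
        pathEdges_reverse, e₁, e₂]
      abel

theorem isTour_cycleInCube (hp : IsValid pick) {T : SimpleGraph V} (hT : T.IsTree) {u₁ u₂ : V}
    (h : T.Adj u₁ u₂) : IsTour (cycleInCube pick T u₁ u₂) := by
  obtain ⟨l, hl, heq⟩ := exists_isSpanningPath_cycleInCube hp hT.isAcyclic h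
  exact ⟨l, hl.nodup, fun v => (hl.mem_iff v).2 (hT.connected.preconnected _ _),
    heq.trans (closedTourEdges_eq hl.head hl.last).symm⟩

theorem mem_cycleInCube {F : SimpleGraph V} {u₁ u₂ : V} (h : F.Adj u₁ u₂) :
    s(u₁, u₂) ∈ cycleInCube pick F u₁ u₂ := by
  rw [cycleInCube_eq pick h]
  simp

theorem spur_add_singleton {F : SimpleGraph V} {u w : V} (h₁ : componentSize F u ≠ 1)
    (h₂ : componentSize F u ≠ 2) (h : F.Adj u w) :
    spur pick F u w + {s(u, w)} = cycleInCube pick F u w := by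
  classical
  rw [spur, if_neg h₁, if_neg h₂, add_comm, Multiset.singleton_add]
  exact Multiset.cons_erase (mem_cycleInCube h)

end Recursion

/-! ### Weights of forest components. -/

section Weights

open SimpleGraph

variable {d : ℕ} {P : Finset (Pt d)} {α : ℝ}

theorem edgeWeight_mk (α : ℝ) (p q : P) :
    edgeWeight α s(p, q) = dist (p : Pt d) (q : Pt d) ^ α := rfl

theorem edgeWeight_nonneg (α : ℝ) (e : Sym2 P) : 0 ≤ edgeWeight α e := by
  induction e with
  | h p q => exact Real.rpow_nonneg dist_nonneg _

theorem weight_add (α : ℝ) (M N : Multiset (Sym2 P)) :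
    weight α (M + N) = weight α M + weight α N := by
  simp [weight]

theorem weight_singleton (α : ℝ) (e : Sym2 P) : weight α {e} = edgeWeight α e := by
  simp [weight]

/-- The edges of the component of `F` that contains `u`. -/
noncomputable def componentEdges (F : SimpleGraph P) (u : P) : Finset (Sym2 P) :=
  (Set.toFinite {e | e ∈ F.edgeSet ∧ ∀ v ∈ e, F.Reachable u v}).toFinset

theorem mem_componentEdges {F : SimpleGraph P} {u : P} {e : Sym2 P} :
    e ∈ componentEdges F u ↔ e ∈ F.edgeSet ∧ ∀ v ∈ e, F.Reachable u v := by
  simp [componentEdges]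

/-- The total weight of the edges of the component of `F` that contains `u`. -/
noncomputable def componentWeight (α : ℝ) (F : SimpleGraph P) (u : P) : ℝ :=
  ∑ e ∈ componentEdges F u, edgeWeight α e

theorem componentWeight_nonneg (α : ℝ) (F : SimpleGraph P) (u : P) :
    0 ≤ componentWeight α F u :=
  Finset.sum_nonneg fun e _ => edgeWeight_nonneg α e

theorem edgeWeight_le_componentWeight {F : SimpleGraph P} {u w : P} (h : F.Adj u w) :
    edgeWeight α s(u, w) ≤ componentWeight α F u := by
  refine Finset.single_le_sum (f := edgeWeight α) (fun e _ => edgeWeight_nonneg α e)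
    (mem_componentEdges.2 ⟨h, fun v hv => ?_⟩)
  rcases Sym2.mem_iff.1 hv with rfl | rfl
  · exact .rfl
  · exact h.reachable

theorem add_componentWeight_le {F : SimpleGraph P} (hF : F.IsAcyclic) {u₁ u₂ : P}
    (h : F.Adj u₁ u₂) :
    edgeWeight α s(u₁, u₂) + componentWeight α (F.deleteEdges {s(u₁, u₂)}) u₁
      + componentWeight α (F.deleteEdges {s(u₁, u₂)}) u₂ ≤ componentWeight α F u₁ := by
  classical
  have hmem : ∀ u, s(u₁, u₂) ∉ componentEdges (F.deleteEdges {s(u₁, u₂)}) u := fun u hu => by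
    have := (mem_componentEdges.1 hu).1
    rw [edgeSet_deleteEdges] at this
    exact this.2 rfl
  have hdisj : Disjoint (componentEdges (F.deleteEdges {s(u₁, u₂)}) u₁)
      (componentEdges (F.deleteEdges {s(u₁, u₂)}) u₂) := by
    rw [Finset.disjoint_left]
    intro e h₁ h₂
    induction e with
    | h p q =>
      exact not_reachable_deleteEdges hF h
        (((mem_componentEdges.1 h₁).2 p (by simp)).trans
          ((mem_componentEdges.1 h₂).2 p (by simp)).symm)
  have hle : ∀ {e}, e ∈ (F.deleteEdges {s(u₁, u₂)}).edgeSet → e ∈ F.edgeSet := fun he =>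
    edgeSet_mono (deleteEdges_le _) he
  rw [componentWeight, componentWeight, add_assoc, ← Finset.sum_union hdisj,
    ← Finset.sum_insert (by simp [hmem])]
  refine Finset.sum_le_sum_of_subset_of_nonneg (fun e he => ?_) fun e _ _ => edgeWeight_nonneg α e
  rw [Finset.mem_insert, Finset.mem_union] at he
  rw [mem_componentEdges]
  rcases he with rfl | he | he
  · refine ⟨h, fun v hv => ?_⟩
    rcases Sym2.mem_iff.1 hv with rfl | rfl
    · exact .rfl
    · exact h.reachable
  · exact ⟨hle (mem_componentEdges.1 he).1, fun v hv =>
      (reachable_iff_deleteEdges h v).2 (.inl ((mem_componentEdges.1 he).2 v hv))⟩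
  · exact ⟨hle (mem_componentEdges.1 he).1, fun v hv =>
      (reachable_iff_deleteEdges h v).2 (.inr ((mem_componentEdges.1 he).2 v hv))⟩

theorem componentWeight_eq_graphWeight {T : SimpleGraph P} (hT : T.IsTree) (u : P) :
    componentWeight α T u = graphWeight α T := by
  classical
  rw [componentWeight, graphWeight]
  congr 1
  ext e
  rw [mem_componentEdges, mem_edgeFinset]
  exact ⟨And.left, fun he => ⟨he, fun v _ => hT.connected.preconnected _ _⟩⟩

/-! ### The charging argument. -/

variable {pick : PickRule P}

theorem IsGeometric.isValid (hg : IsGeometric pick) : IsValid pick := fun F u v h =>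
  (hg F u v h).1

/-- Two successive picks happen at the same vertex `u`. The second comes from a subforest, so it was
already a candidate for the first and makes at least as large an angle with `uv`. -/
theorem bend_nextVertex_add_le (hg : IsGeometric pick) {F F' : SimpleGraph P} (hle : F' ≤ F)
    (u v : P) :
    min 1 (2 * bend ((nextVertex pick F u v : P) : Pt d) u v ^ 2)
      + bend ((nextVertex pick F' u (nextVertex pick F u v) : P) : Pt d) u ((nextVertex pick F u v : P) : Pt d)
      ≤ 1 := by
  by_cases h' : componentSize F' u = 1
  · rw [nextVertex.eq_1 pick F', if_pos h', bend_self_left, add_zero]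
    exact min_le_left _ _
  by_cases h : componentSize F u = 1
  · rw [nextVertex.eq_1 pick F u v, if_pos h, bend_self_left]
    norm_num
    exact bend_le_one _ _ _
  have hF := hle (adj_nextVertex hg.isValid (v := nextVertex pick F u v) h')
  apply bend_add_bend_le_one
  rw [nextVertex.eq_1 pick F u v, if_neg h] at hF ⊢
  exact (hg F u v ⟨_, hF⟩).2 _ hF

/-- The bound for one side of the current edge `uv`: the rest of the path, plus the contribution of
its first edge to the shortcut of `uv`. -/
theorem weight_spur_add_le (hα : 2 ≤ α) (hg : IsGeometric pick) {F : SimpleGraph P}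
    (ih : ∀ u w, F.Adj u w → weight α (cycleInCube pick F u w) ≤ edgeWeight α s(u, w)
      + (3 ^ (α - 1) + Real.sqrt 6 ^ α / 3) * (componentWeight α F u - edgeWeight α s(u, w))
      + coeff α (bend ((nextVertex pick (F.deleteEdges {s(u, w)}) u w : P) : Pt d) u w)
        * edgeWeight α s(u, w)) (u v : P) :
    weight α (spur pick F u (nextVertex pick F u v))
      + coeff α (min 1 (2 * bend ((nextVertex pick F u v : P) : Pt d) u v ^ 2))
        * edgeWeight α s(u, nextVertex pick F u v)
      ≤ (3 ^ (α - 1) + Real.sqrt 6 ^ α / 3) * componentWeight α F u := by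
  have hpos : 0 ≤ (3 : ℝ) ^ (α - 1) + Real.sqrt 6 ^ α / 3 := by positivity
  by_cases h1 : componentSize F u = 1
  · have : edgeWeight α s(u, nextVertex pick F u v) = 0 := by
      rw [nextVertex, if_pos h1, edgeWeight_mk, _root_.dist_self, Real.zero_rpow (by linarith)]
    rw [this, spur, if_pos h1]
    simpa [weight] using mul_nonneg hpos (componentWeight_nonneg α F u)
  have hadj := adj_nextVertex hg.isValid (v := v) h1
  have hw := edgeWeight_nonneg α s(u, nextVertex pick F u v)
  by_cases h2 : componentSize F u = 2
  · rw [spur, if_neg h1, if_pos h2, weight_singleton]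
    calc _ = (1 + coeff α (min 1 (2 * bend ((nextVertex pick F u v : P) : Pt d) u v ^ 2)))
        * edgeWeight α s(u, nextVertex pick F u v) := by ring
      _ ≤ _ := mul_le_mul (one_add_coeff_le hα (min_le_left _ _))
        (edgeWeight_le_componentWeight hadj) hw hpos
  -- Erasing the picked edge cancels its cost `1` in the induction hypothesis. It is left with its
  -- charges as middle edge and as outer edge, whose parameters sum to at most `1`.
  · have e := ih _ _ hadj
    have hb := coeff_add_coeff_le hα (bend_nextVertex_add_le hg
      (F.deleteEdges_le {s(u, nextVertex pick F u v)}) u v)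
    have := mul_le_mul_of_nonneg_right hb hw
    have hspur := congrArg (weight α) (spur_add_singleton (pick := pick) h1 h2 hadj)
    rw [weight_add, weight_singleton] at hspur
    linarith

/-- For the induction, the cost of the current edge and its charge as middle edge are kept apart
from the `ρ`-bound on the other edges: the caller erases the edge and adds a charge that depends on
the same vertex `u₁`. -/
theorem weight_cycleInCube_le (hα : 2 ≤ α) (hg : IsGeometric pick) {F : SimpleGraph P}
    (hF : F.IsAcyclic) {u₁ u₂ : P} (h : F.Adj u₁ u₂) :
    weight α (cycleInCube pick F u₁ u₂) ≤ edgeWeight α s(u₁, u₂)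
      + (3 ^ (α - 1) + Real.sqrt 6 ^ α / 3) * (componentWeight α F u₁ - edgeWeight α s(u₁, u₂))
      + coeff α (bend ((nextVertex pick (F.deleteEdges {s(u₁, u₂)}) u₁ u₂ : P) : Pt d) u₁ u₂)
        * edgeWeight α s(u₁, u₂) := by
  induction hn : F.edgeSet.ncard using Nat.strong_induction_on generalizing F u₁ u₂ with
  | _ n ih =>
    subst hn
    have ih' := fun (u w : P) (huw : (F.deleteEdges {s(u₁, u₂)}).Adj u w) =>
      ih _ (ncard_deleteEdges_lt h) (hF.anti (deleteEdges_le _)) huw rfl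
    have s₁ := weight_spur_add_le hα hg ih' u₁ u₂
    have s₂ := weight_spur_add_le hα hg ih' u₂ u₁
    have hW := mul_le_mul_of_nonneg_left (add_componentWeight_le (α := α) hF h)
      (show 0 ≤ (3 : ℝ) ^ (α - 1) + Real.sqrt 6 ^ α / 3 by positivity)
    rw [cycleInCube_eq pick h, weight_add, weight_add, weight_add, weight_singleton,
      weight_singleton]
    have hs := shortcut_le hα ((nextVertex pick (F.deleteEdges {s(u₁, u₂)}) u₁ u₂ : P) : Pt d) u₁ u₂
      ((nextVertex pick (F.deleteEdges {s(u₁, u₂)}) u₂ u₁ : P) : Pt d)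
    simp only [← edgeWeight_mk] at hs
    linarith

theorem weight_cycleInCube_le_graphWeight (hα : 2 ≤ α) (hg : IsGeometric pick)
    {T : SimpleGraph P} (hT : T.IsTree) {u₁ u₂ : P} (h : T.Adj u₁ u₂) :
    weight α (cycleInCube pick T u₁ u₂)
      ≤ (3 ^ (α - 1) + Real.sqrt 6 ^ α / 3) * graphWeight α T := by
  have h1 := weight_cycleInCube_le hα hg hT.isAcyclic h
  rw [componentWeight_eq_graphWeight hT] at h1
  have h2 := mul_le_mul_of_nonneg_right (one_add_coeff_le hα (bend_le_one
    ((nextVertex pick (T.deleteEdges {s(u₁, u₂)}) u₁ u₂ : P) : Pt d) u₁ u₂))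
    (edgeWeight_nonneg α s(u₁, u₂))
  linarith

/-! ### Comparison with an arbitrary tour, and existence of an output. -/

/-- A closed tour contains a spanning tree. -/
theorem IsMST.graphWeight_le {T : SimpleGraph P} (hT : IsMST α T) {M : Multiset (Sym2 P)}
    (hM : IsTour M) : graphWeight α T ≤ weight α M := by
  classical
  obtain ⟨l, -, hl, rfl⟩ := hM
  obtain ⟨v₀⟩ := hT.1.connected.nonempty
  obtain ⟨a, t, rfl⟩ := List.exists_cons_of_ne_nil (List.ne_nil_of_mem (hl v₀))
  have hclosed := closedTourEdges_eq (l := a :: t) (a := a) (by simp)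
    (List.getLast?_eq_getLast_of_ne_nil (List.cons_ne_nil a t))
  let G : SimpleGraph P := fromEdgeSet {e | e ∈ closedTourEdges (a :: t)}
  have hreach : ∀ v, G.Reachable a v := fun v => by
    refine reachable_of_pathEdges (fun u v huv => ?_) v (hl v)
    by_cases huv' : u = v
    · exact huv' ▸ .rfl
    · refine Adj.reachable ((fromEdgeSet_adj _).2 ⟨?_, huv'⟩)
      rw [Set.mem_ofPred_eq, hclosed]
      exact Multiset.mem_add.2 (.inl huv)
  have hG : G.Connected :=
    { preconnected := fun u v => (hreach u).symm.trans (hreach v), nonempty := ⟨a⟩ }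
  obtain ⟨T', hle, hT'⟩ := hG.exists_isTree_le
  refine (hT.2 T' hT').trans ?_
  -- Tree edges are distinct, so containment of sets gives containment of multisets; the leftover
  -- tour edges have nonnegative weight.
  have hsub : T'.edgeFinset.val ≤ closedTourEdges (a :: t) := by
    rw [Multiset.le_iff_subset T'.edgeFinset.nodup]
    intro e he
    have := edgeSet_mono hle (mem_edgeFinset.1 he)
    rw [edgeSet_fromEdgeSet] at this
    exact this.1
  obtain ⟨R, hR⟩ := Multiset.le_iff_exists_add.1 hsub
  have hnn : 0 ≤ weight α R := by
    refine Multiset.sum_nonneg fun x hx => ?_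
    obtain ⟨e, -, rfl⟩ := Multiset.mem_map.1 hx
    exact edgeWeight_nonneg α e
  rw [hR, weight_add]
  have : graphWeight α T' = weight α T'.edgeFinset.val := by
    rw [graphWeight, weight, Finset.sum]
  linarith

theorem exists_isMST (hP : P.Nonempty) (α : ℝ) : ∃ T : SimpleGraph P, IsMST α T := by
  classical
  have : Nonempty P := hP.to_subtype
  obtain ⟨T₀, -, hT₀⟩ := (connected_top (V := P)).exists_isTree_le
  obtain ⟨T, hT, hmin⟩ := Set.exists_min_image {T : SimpleGraph P | T.IsTree} (graphWeight α)
    (Set.toFinite _) ⟨T₀, hT₀⟩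
  exact ⟨T, hT, hmin⟩

theorem exists_isGeometric (P : Finset (Pt d)) : ∃ pick : PickRule P, IsGeometric pick := by
  have : ∀ (F : SimpleGraph P) (u v : P), ∃ x, (∃ w, F.Adj u w) → F.Adj u x ∧
      ∀ w, F.Adj u w → EuclideanGeometry.angle (x : Pt d) (u : Pt d) (v : Pt d) ≤
          EuclideanGeometry.angle (w : Pt d) (u : Pt d) (v : Pt d) := fun F u v => by
    by_cases h : ∃ w, F.Adj u w
    · obtain ⟨x, hx, hmin⟩ := Set.exists_min_image {w | F.Adj u w}
        (fun w : P => EuclideanGeometry.angle (w : Pt d) (u : Pt d) (v : Pt d)) (Set.toFinite _) h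
      exact ⟨x, fun _ => ⟨hx, hmin⟩⟩
    · exact ⟨u, fun h' => absurd h' h⟩
  choose pick hpick using this
  exact ⟨pick, hpick⟩

theorem exists_geometricT3 (α : ℝ) (hP : 2 ≤ P.card) : ∃ M, GeometricT3 α P M := by
  obtain ⟨T, hT⟩ := exists_isMST (P := P) (Finset.card_pos.1 (by omega)) α
  obtain ⟨pick, hpick⟩ := exists_isGeometric P
  have : Nontrivial P := by
    rw [← Fintype.one_lt_card_iff_nontrivial, Fintype.card_coe]
    omega
  obtain ⟨u⟩ := hT.1.connected.nonempty
  obtain ⟨v, huv⟩ := hT.1.connected.preconnected.exists_adj_of_nontrivial u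
  exact ⟨_, T, pick, u, v, hT, hpick, huv, rfl⟩

theorem isApproximation_geometricT3 (d : ℕ) (hα : 2 ≤ α) :
    IsApproximation d α ((3 : ℝ) ^ (α - 1) + Real.sqrt 6 ^ α / 3)
      (fun P M => GeometricT3 α P M) := by
  refine fun P hP => ⟨exists_geometricT3 α hP, ?_⟩
  rintro M ⟨T, pick, u₁, u₂, hT, hg, h, rfl⟩
  refine ⟨isTour_cycleInCube hg.isValid hT.1 h, fun M' hM' => ?_⟩
  exact (weight_cycleInCube_le_graphWeight hα hg hT.1 h).trans
    (mul_le_mul_of_nonneg_left (hT.graphWeight_le hM') (by positivity))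

end Weights

end GeomT3

theorem mainTheorem2 (α : ℝ) (hα : 2 ≤ α) :
    GeomT3.IsApproximation 2 α ((3 : ℝ) ^ (α - 1) + Real.sqrt 6 ^ α / 3)
      (fun P M => GeomT3.GeometricT3 α P M) :=
  GeomT3.isApproximation_geometricT3 2 hα
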